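/- Conventions. For functions $f,g:\mathbb{R}^{\ge 0}\to[0,\infty]$ write $f\preceq g$ (equivalently $g\succeq f$) if there is $C>0$ with $f(x)\le C\,g(Cx+C)+Cx+C$ for all $x\ge 0$. If $F<B$ are groups with finite generating sets $T$ and $S$ respectively, the distortion function of $F$ in $B$ is $\delta(x)=\max\{|g|_T : g\in F,\ |g|_S\le x\}$, where $|\cdot|$ denotes word length. Let $G$ be a group acting freely and geometrically (cellularly and cocompactly) on a simply connected cell complex $X$. For $R=\mathbb{Z}$ or $R=\mathbb{Q}$, let the mass of a cellular chain be its $\ell^1$-norm, and put \[\mathrm{FV}^2_{X;R}(x)=\sup_{\alpha}\ \inf\{\mathrm{Mass}(\beta) : \beta\in C_2(X;R),\ \partial\beta=\alpha\},\] where $\alpha$ ranges over the integral $1$-cycles $\alpha\in Z_1(X;\mathbb{Z})$ of mass at most $x$. For a finite abelian group $R$, let the mass of a chain be the number of cells in its support, and define $\mathrm{FV}^2_{X;R}(x)$ by the same formula, with $\alpha$ ranging over the cycles $\alpha\in Z_1(X;R)$ of mass at most $x$. The growth type of $\mathrm{FV}^2_{X;R}$ depends only on $G$, and $\mathrm{FV}^2_{G;R}$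 denotes $\mathrm{FV}^2_{X;R}$ for any such $X$. Lemma. Let $B$ be a finitely presented group and let $F<B$ be a finitely generated subgroup with distortion function $\delta$ (with respect to any finite generating sets). Then the double $B*_F B$ is finitely presented, and for every coefficient group $R$ (that is, $R=\mathbb{Z}$, $R=\mathbb{Q}$, or $R$ a nontrivial finite abelian group), \[\mathrm{FV}^2_{B*_F B;R}(x)\succeq\delta(x);\] that is, $\delta\preceq \mathrm{FV}^2_{X;R}$ for every simply connected cell complex $X$ on which $B*_F B$ acts freely and geometrically. -/

import Mathlib

open scoped ENNReal NNReal

universe u v w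

noncomputable section

namespace HomFill

/-! ### Growth rates, word length, distortion, doubles -/

/-- `GrowthLE f g` is the relation `f ≼ g` on growth rates: for some `C > 0`,
`f x ≤ C * g (C * x + C) + C * x + C` for every `x ≥ 0`. -/
def GrowthLE (f g : ℝ≥0 → ℝ≥0∞) : Prop :=
  ∃ C : ℝ≥0, 0 < C ∧ ∀ x : ℝ≥0, f x ≤ C * g (C * x + C) + C * x + C

/-- The word length of `g` with respect to `S`: the least length of a word in the letters
`S ∪ S⁻¹` representing `g` (and `⊤` if there is none). -/
def wordLength {G : Type*} [Group G] (S : Set G) (g : G) : ℕ∞ :=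
  ⨅ (l : List G) (_ : (∀ a ∈ l, a ∈ S ∨ a⁻¹ ∈ S) ∧ l.prod = g), (l.length : ℕ∞)

/-- The distortion function of the subgroup `F` in `B`, with respect to a generating set `S`
of `B` and a generating set `T` of `F`:
`x ↦ max {|g|_T : g ∈ F, |g|_S ≤ x}` (the supremum is a maximum when `S` and `T` are finite
generating sets, since the ball in question is then finite). -/
def distortion {B : Type*} [Group B] (F : Subgroup B) (S : Set B) (T : Set F) (x : ℝ≥0) :
    ℝ≥0∞ :=
  ⨆ (g : F) (_ : (wordLength S (g : B) : ℝ≥0∞) ≤ x), (wordLength T g : ℝ≥0∞)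

/-- The double `B *_F B`: the amalgamated free product of two copies of `B` along the
inclusions of the subgroup `F`. -/
abbrev Double {B : Type*} [Group B] (F : Subgroup B) : Type _ :=
  Monoid.PushoutI (fun _ : Fin 2 => F.subtype)

/-! ### Combinatorial 2-complexes -/

/-- A graph, possibly with loops and multiple edges, with a chosen orientation of each edge. -/
structure OrGraph where
  Vert : Type u
  Edge : Type u
  src : Edge → Vert
  tgt : Edge → Vert

/-- `X.IsWalk u p v`: the list `p` is an edge path from `u` to `v`. The letter `(e, true)`
traverses `e` from its source to its target, and `(e, false)` traverses it backwards. -/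
def OrGraph.IsWalk (X : OrGraph.{u}) : X.Vert → List (X.Edge × Bool) → X.Vert → Prop
  | a, [], b => a = b
  | a, (e, true) :: p, b => a = X.src e ∧ X.IsWalk (X.tgt e) p b
  | a, (e, false) :: p, b => a = X.tgt e ∧ X.IsWalk (X.src e) p b

/-- A combinatorial 2-complex: a graph with 2-cells attached along closed edge paths
(possibly constant ones). This is all the data of the 2-skeleton of a cell complex that enters
its fundamental group and its cellular chains in degrees at most 2. -/
structure TwoComplex extends OrGraph.{u} where
  Face : Type u
  base : Face → Vert
  bdry : Face → List (Edge × Bool)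
  bdry_isWalk : ∀ d, toOrGraph.IsWalk (base d) (bdry d) (base d)

namespace TwoComplex

variable (X : TwoComplex.{u})

/-- The elementary moves on edge paths: insert a backtracking, or insert the boundary path of
a 2-cell. -/
inductive Move : List (X.Edge × Bool) → List (X.Edge × Bool) → Prop
  | backtrack (p q : List (X.Edge × Bool)) (e : X.Edge) (b : Bool) :
      Move (p ++ q) (p ++ [(e, b), (e, !b)] ++ q)
  | cell (p q : List (X.Edge × Bool)) (d : X.Face) :
      Move (p ++ q) (p ++ X.bdry d ++ q)

/-- Homotopy, relative to the endpoints, of edge paths from `a` to `b`: the equivalence relation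
generated by the elementary moves between edge paths from `a` to `b`. -/
def Homotopic (a b : X.Vert) : List (X.Edge × Bool) → List (X.Edge × Bool) → Prop :=
  Relation.EqvGen fun p q => X.IsWalk a p b ∧ X.IsWalk a q b ∧ X.Move p q

/-- The complex is 1-connected: nonempty, connected, and every closed edge path is homotopic to
the constant one. -/
structure SimplyConnected : Prop where
  nonempty : Nonempty X.Vert
  connected : ∀ a b, ∃ p, X.IsWalk a p b
  null : ∀ a p, X.IsWalk a p a → X.Homotopic a a p []

/-- The group `G`, acting on the cells of `X`, acts cellularly, freely and cocompactly. (Under a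
free geometric cellular action on a cell complex every cell has trivial stabilizer, so that the
orientations of the edges and the orientations and base points of the boundary paths of the
2-cells can be chosen equivariantly, as they are here; freeness on edges and 2-cells follows
from freeness on vertices.) -/
structure IsFreeGeometricAction (G : Type v) [Group G]
    [MulAction G X.Vert] [MulAction G X.Edge] [MulAction G X.Face] : Prop where
  src_smul : ∀ (g : G) (e : X.Edge), X.src (g • e) = g • X.src e
  tgt_smul : ∀ (g : G) (e : X.Edge), X.tgt (g • e) = g • X.tgt e
  base_smul : ∀ (g : G) (d : X.Face), X.base (g • d) = g • X.base d
  bdry_smul : ∀ (g : G) (d : X.Face),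
    X.bdry (g • d) = (X.bdry d).map fun s => (g • s.1, s.2)
  free : ∀ (g : G) (a : X.Vert), g • a = a → g = 1
  finite_vert : Finite (MulAction.orbitRel.Quotient G X.Vert)
  finite_edge : Finite (MulAction.orbitRel.Quotient G X.Edge)
  finite_face : Finite (MulAction.orbitRel.Quotient G X.Face)

/-! ### Cellular chains and filling functions -/

/-- The cellular boundary `C₁(X; R) → C₀(X; R)`. -/
def boundary₁ (R : Type*) [AddCommGroup R] : (X.Edge →₀ R) →+ (X.Vert →₀ R) :=
  Finsupp.liftAddHom fun e =>
    (Finsupp.singleAddHom (X.tgt e) - Finsupp.singleAddHom (X.src e) : R →+ (X.Vert →₀ R))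

/-- The cellular boundary `C₂(X; R) → C₁(X; R)`: a 2-cell is sent to the signed sum of the edges
on its boundary path. -/
def boundary₂ (R : Type*) [AddCommGroup R] : (X.Face →₀ R) →+ (X.Edge →₀ R) :=
  Finsupp.liftAddHom fun d =>
    ((X.bdry d).map fun s =>
      if s.2 then (Finsupp.singleAddHom s.1 : R →+ (X.Edge →₀ R))
      else -(Finsupp.singleAddHom s.1 : R →+ (X.Edge →₀ R))).sum

end TwoComplex

/-- The mass of a chain with integer or rational coefficients: its `ℓ¹`-norm. -/
def normMass {ι R : Type*} [NormedRing R] (c : ι →₀ R) : ℝ≥0∞ :=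
  c.sum fun _ r => ‖r‖ₑ

/-- The mass of a chain with coefficients in a finite group: the number of cells in its
support. -/
def countMass {ι R : Type*} [AddCommGroup R] (c : ι →₀ R) : ℝ≥0∞ :=
  (c.support.card : ℝ≥0∞)

namespace TwoComplex

variable (X : TwoComplex.{u})

/-- The filling volume of a 1-cycle, for coefficients in `R = ℤ` or `R = ℚ`. -/
def normFillVol (R : Type*) [NormedRing R] (α : X.Edge →₀ R) : ℝ≥0∞ :=
  ⨅ (β : X.Face →₀ R) (_ : X.boundary₂ R β = α), normMass β

/-- The filling function `FV²_{X;R}` for `R = ℤ` or `R = ℚ`: the supremum of the filling volumes,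
by 2-chains with coefficients in `R`, of the *integral* 1-cycles of mass at most `x`. -/
def normFV (R : Type*) [NormedRing R] (x : ℝ≥0) : ℝ≥0∞ :=
  ⨆ (α : X.Edge →₀ ℤ) (_ : X.boundary₁ ℤ α = 0) (_ : normMass α ≤ x),
    X.normFillVol R (Finsupp.mapRange.addMonoidHom (Int.castAddHom R) α)

/-- The filling volume of a 1-cycle, for coefficients in a finite abelian group `R`. -/
def finFillVol (R : Type*) [AddCommGroup R] (α : X.Edge →₀ R) : ℝ≥0∞ :=
  ⨅ (β : X.Face →₀ R) (_ : X.boundary₂ R β = α), countMass β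

/-- The filling function `FV²_{X;R}` for a finite abelian group `R`: the supremum of the filling
volumes of the 1-cycles with coefficients in `R` of mass at most `x`. -/
def finFV (R : Type*) [AddCommGroup R] (x : ℝ≥0) : ℝ≥0∞ :=
  ⨆ (α : X.Edge →₀ R) (_ : X.boundary₁ R α = 0) (_ : countMass α ≤ x), X.finFillVol R α

end TwoComplex

end HomFill

end

namespace HomFill

/-! ### Finite presentability of doubles -/

namespace Double

/-! Let `D` be the double. A word of length `n` in the generators of `B` with value `g ∈ F` can be
read in either copy of `B`; since the copies agree on `g`, this gives two paths in `X` with common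
endpoints, hence a loop of length `O(n)`. Mapped to the Bass-Serre tree, whose edges form `D/F`, the
loop crosses the edge `F` at the points `1` and `g`. A filling meets the preimage of that edge in a
1-chain joining these two points, and each 2-cell contributes only boundedly many steps in `F`, so
its mass is at least about `|g|_T`.

The proof is dual to this picture. The map to the tree becomes an equivariant 0-cochain `q` with
values in `ℤ[D/F]` (`Double.exists_derivation`), and its coboundary is lifted to an equivariant
1-cochain `φ` with values in `ℤ[D]` (`exists_edge_cochain`). Sums of `φ` around 2-cells lie in the
left ideal generated by the `t - 1`, `t ∈ F`. Composing `φ` with the sum of coefficients over `{k <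
height}` gives integral cochains `c k`. As `height` varies boundedly under right translation by a
fixed `t`, the total of `|c k|` over all `k` is bounded uniformly on the boundaries of 2-cells
(`exists_narrow_bdry`). On the loop each `c k` with `k < |g|_T` is `-1` up to a total error `O(n)`
(`exists_cochains`). Summing over `k` bounds the mass of any filling
(`IsWeight.le_mass_of_boundary₂_eq`). Only integral cochains are used, so one argument serves all
coefficients. -/

/-- The two inclusions of `B` into the double `B *_F B`. -/
def incl {B : Type u} [Group B] (F : Subgroup B) (i : Fin 2) : B →* Double F :=
  Monoid.PushoutI.of (φ := fun _ : Fin 2 => F.subtype) i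

variable {B : Type u} [Group B] (F : Subgroup B)

theorem incl_coe (i j : Fin 2) (t : F) : incl F i t = incl F j t :=
  (Monoid.PushoutI.of_apply_eq_base (fun _ : Fin 2 => F.subtype) i t).trans
    (Monoid.PushoutI.of_apply_eq_base (fun _ : Fin 2 => F.subtype) j t).symm

theorem exists_lift {K : Type*} [Monoid K] (f₀ f₁ : B →* K) (h : ∀ t : F, f₀ t = f₁ t) :
    ∃ f : Double F →* K, f.comp (incl F 0) = f₀ ∧ f.comp (incl F 1) = f₁ := by
  let k : Double F →* K := Monoid.PushoutI.lift ![f₀, f₁] (f₀.comp F.subtype)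
    (Fin.forall_fin_two.2 ⟨rfl, MonoidHom.ext fun t => (h t).symm⟩)
  have hk (i : Fin 2) (b : B) : k (incl F i b) = ![f₀, f₁] i b :=
    Monoid.PushoutI.lift_of (φ := fun _ : Fin 2 => F.subtype) ![f₀, f₁] _ _ b
  exact ⟨k, MonoidHom.ext (hk 0), MonoidHom.ext (hk 1)⟩

variable {F}

theorem induction_on {p : Double F → Prop} (x : Double F) (h₀ : ∀ b, p (incl F 0 b))
    (h₁ : ∀ b, p (incl F 1 b)) (mul : ∀ x y, p x → p y → p (x * y)) : p x := by
  induction x using Monoid.PushoutI.induction_on with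
  | of i g => exact Fin.forall_fin_two (p := fun i => ∀ g, p (incl F i g)).2 ⟨h₀, h₁⟩ i g
  | base t =>
    rw [← Monoid.PushoutI.of_apply_eq_base _ 0]
    exact h₀ t
  | mul x y hx hy => exact mul x y hx hy

variable (F)

/-- Folding the two copies together retracts the double onto `B`. -/
theorem incl_injective (i : Fin 2) : Function.Injective (incl F i) := by
  obtain ⟨f, h₀, h₁⟩ := exists_lift F (MonoidHom.id B) (MonoidHom.id B) fun _ => rfl
  have h : ∀ i, f.comp (incl F i) = MonoidHom.id B := Fin.forall_fin_two.2 ⟨h₀, h₁⟩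
  exact Function.LeftInverse.injective (g := f) (DFunLike.congr_fun (h i))

/-- The double is the free product `B * B` with the two copies of each generator of `F` identified;
finitely many relations suffice. -/
theorem isFinitelyPresented (hB : Group.IsFinitelyPresented B) (hF : F.FG) :
    Group.IsFinitelyPresented (Double F) := by
  obtain ⟨T, hT⟩ := (Group.fg_iff_subgroup_fg F).2 hF
  let f : Monoid.Coprod B B →* Double F := Monoid.Coprod.lift (incl F 0) (incl F 1)
  let r : F → Monoid.Coprod B B := fun t =>
    Monoid.Coprod.inl (t : B) * (Monoid.Coprod.inr (t : B))⁻¹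
  let N := Subgroup.normalClosure (r '' T)
  let mk := QuotientGroup.mk' N
  -- Agreement on generators of `F` gives agreement on `F`, so the quotient map factors through the
  -- double; this puts the kernel of `f` inside `N`.
  have agree : (mk.comp Monoid.Coprod.inl).comp F.subtype
      = (mk.comp Monoid.Coprod.inr).comp F.subtype := by
    refine MonoidHom.eq_of_eqOn_dense hT fun t ht => ?_
    have h : mk (r t) = 1 :=
      (QuotientGroup.eq_one_iff _).2 (Subgroup.subset_normalClosure ⟨t, ht, rfl⟩)
    simpa [r, mul_inv_eq_one] using h
  obtain ⟨k, hk₀, hk₁⟩ := exists_lift F (mk.comp Monoid.Coprod.inl) (mk.comp Monoid.Coprod.inr)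
    (DFunLike.congr_fun agree)
  have k_comp : k.comp f = mk := by
    ext b
    · simpa [f] using DFunLike.congr_fun hk₀ b
    · simpa [f] using DFunLike.congr_fun hk₁ b
  refine Group.IsFinitelyPresented.of_surjective f (fun x => ?_)
    ⟨r '' T, T.finite_toSet.image _, le_antisymm ?_ fun x hx => ?_⟩
  · change x ∈ f.range
    exact induction_on x (fun b => ⟨Monoid.Coprod.inl b, by simp [f]⟩)
      (fun b => ⟨Monoid.Coprod.inr b, by simp [f]⟩) fun x y hx hy => mul_mem hx hy
  · refine Subgroup.normalClosure_le_normal ?_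
    rintro _ ⟨t, -, rfl⟩
    simp [r, f, MonoidHom.mem_ker, incl_coe F 0 1]
  · refine (QuotientGroup.eq_one_iff x).1 ?_
    change mk x = 1
    rw [← k_comp, MonoidHom.comp_apply, MonoidHom.mem_ker.1 hx, map_one]

end Double

/-! ### Edge paths and chains -/

/-- The signed sum along an edge path of a function on the edges. -/
def pathSum {E A : Type*} [AddCommGroup A] (φ : E → A) (p : List (E × Bool)) : A :=
  (p.map fun s => if s.2 then φ s.1 else -φ s.1).sum

section PathSum

variable {E A A' : Type*} [AddCommGroup A] [AddCommGroup A'] (φ : E → A)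

@[simp] theorem pathSum_nil : pathSum φ [] = 0 := rfl

@[simp] theorem pathSum_cons (s : E × Bool) (p : List (E × Bool)) :
    pathSum φ (s :: p) = (if s.2 then φ s.1 else -φ s.1) + pathSum φ p := by
  simp [pathSum]

theorem pathSum_append (p q : List (E × Bool)) :
    pathSum φ (p ++ q) = pathSum φ p + pathSum φ q := by
  simp [pathSum]

theorem map_pathSum (f : A →+ A') (p : List (E × Bool)) :
    f (pathSum φ p) = pathSum (fun e => f (φ e)) p := by
  induction p with
  | nil => simp
  | cons s p ih => rw [pathSum_cons, pathSum_cons, map_add, ih]; split_ifs <;> simp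

theorem pathSum_map {G : Type*} [Group G] [MulAction G E] (g : G) (p : List (E × Bool)) :
    pathSum φ (p.map fun s => (g • s.1, s.2)) = pathSum (fun e => φ (g • e)) p := by
  induction p with
  | nil => simp
  | cons s p ih => simp [ih]

end PathSum

namespace OrGraph

variable {X : OrGraph.{u}}

theorem IsWalk.append {a b c : X.Vert} {p q : List (X.Edge × Bool)}
    (hp : X.IsWalk a p b) (hq : X.IsWalk b q c) : X.IsWalk a (p ++ q) c := by
  induction p generalizing a with
  | nil => cases hp; exact hq
  | cons s p ih =>
    obtain ⟨e, _ | _⟩ := s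
    · exact ⟨hp.1, ih hp.2⟩
    · exact ⟨hp.1, ih hp.2⟩

theorem IsWalk.smul {G : Type*} [Group G] [MulAction G X.Vert] [MulAction G X.Edge]
    (hsrc : ∀ (g : G) (e : X.Edge), X.src (g • e) = g • X.src e)
    (htgt : ∀ (g : G) (e : X.Edge), X.tgt (g • e) = g • X.tgt e) (g : G)
    {a b : X.Vert} {p : List (X.Edge × Bool)} (hp : X.IsWalk a p b) :
    X.IsWalk (g • a) (p.map fun s => (g • s.1, s.2)) (g • b) := by
  induction p generalizing a with
  | nil => cases hp; rfl
  | cons s p ih =>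
    obtain ⟨e, _ | _⟩ := s
    · refine ⟨by rw [htgt, hp.1], ?_⟩
      rw [hsrc]
      exact ih hp.2
    · refine ⟨by rw [hsrc, hp.1], ?_⟩
      rw [htgt]
      exact ih hp.2

theorem IsWalk.pathSum_eq {A : Type*} [AddCommGroup A] {φ : X.Edge → A} {q : X.Vert → A}
    (hφ : ∀ e, φ e = q (X.tgt e) - q (X.src e)) {a b : X.Vert} {p : List (X.Edge × Bool)}
    (hp : X.IsWalk a p b) : pathSum φ p = q b - q a := by
  induction p generalizing a with
  | nil => cases hp; simp
  | cons s p ih =>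
    obtain ⟨e, _ | _⟩ := s
    · rw [pathSum_cons, ih hp.2, hp.1]
      simp [hφ]
    · rw [pathSum_cons, ih hp.2, hp.1]
      simp [hφ]

end OrGraph

/-- The evaluation of an integral cochain on chains with arbitrary coefficients. -/
noncomputable def evalChain {E R : Type*} [AddCommGroup R] (c : E → ℤ) : (E →₀ R) →+ R :=
  Finsupp.liftAddHom fun e => zsmulAddGroupHom (c e)

theorem evalChain_single {E R : Type*} [AddCommGroup R] (c : E → ℤ) (e : E) (r : R) :
    evalChain c (Finsupp.single e r) = c e • r := by
  simp [evalChain]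

theorem evalChain_mapRange {E R : Type*} [AddCommGroup R] (c : E → ℤ) (ρ : ℤ →+ R)
    (α : E →₀ ℤ) :
    evalChain c (Finsupp.mapRange.addMonoidHom ρ α) = ρ (evalChain c α) := by
  have : (evalChain c).comp (Finsupp.mapRange.addMonoidHom ρ) = ρ.comp (evalChain c) := by
    ext e
    simp [evalChain_single, ← map_zsmul]
  exact DFunLike.congr_fun this α

namespace TwoComplex

variable (X : TwoComplex.{u})

theorem boundary₂_single {R : Type*} [AddCommGroup R] (d : X.Face) (r : R) :
    X.boundary₂ R (Finsupp.single d r) = pathSum (fun e => Finsupp.single e r) (X.bdry d) := by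
  simp only [boundary₂, Finsupp.liftAddHom_apply_single]
  generalize X.bdry d = p
  induction p with
  | nil => simp
  | cons s p ih =>
    rw [pathSum_cons, ← ih, List.map_cons, List.sum_cons, AddMonoidHom.add_apply]
    split_ifs <;> simp

theorem evalChain_boundary₂ {R : Type*} [AddCommGroup R] (c : X.Edge → ℤ) (β : X.Face →₀ R) :
    evalChain c (X.boundary₂ R β) = β.sum fun d r => pathSum c (X.bdry d) • r := by
  have : (evalChain c).comp (X.boundary₂ R) = evalChain fun d => pathSum c (X.bdry d) := by
    ext d r
    simp only [AddMonoidHom.comp_apply, Finsupp.singleAddHom_apply, boundary₂_single,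
      evalChain_single, map_pathSum]
    exact (map_pathSum c (zmultiplesHom R r) _).symm
  exact DFunLike.congr_fun this β

/-- The integral chain of an edge path. -/
noncomputable def pathChain (p : List (X.Edge × Bool)) : X.Edge →₀ ℤ :=
  pathSum (fun e => Finsupp.single e 1) p

variable {X}

theorem evalChain_pathChain (c : X.Edge → ℤ) (p : List (X.Edge × Bool)) :
    evalChain c (X.pathChain p) = pathSum c p := by
  simp [pathChain, map_pathSum, evalChain_single]

theorem boundary₁_mapRange_pathChain {R : Type*} [AddCommGroup R] (ρ : ℤ →+ R) {a b : X.Vert}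
    {p : List (X.Edge × Bool)} (hp : X.IsWalk a p b) :
    X.boundary₁ R (Finsupp.mapRange.addMonoidHom ρ (X.pathChain p))
      = Finsupp.single b (ρ 1) - Finsupp.single a (ρ 1) := by
  rw [pathChain, map_pathSum, map_pathSum]
  exact hp.pathSum_eq (q := fun a => Finsupp.single a (ρ 1)) fun e => by simp [boundary₁]

end TwoComplex

/-! ### Masses -/

/-- A weight on a coefficient group: a function vanishing at `0`, symmetric and subadditive. -/
structure IsWeight {R : Type*} [AddCommGroup R] (ν : R → ℝ≥0∞) : Prop where
  zero : ν 0 = 0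
  neg : ∀ r, ν (-r) = ν r
  add_le : ∀ r s, ν (r + s) ≤ ν r + ν s

theorem isWeight_enorm (R : Type*) [NormedRing R] : IsWeight fun r : R => ‖r‖ₑ :=
  ⟨enorm_zero, enorm_neg, enorm_add_le⟩

open Classical in
/-- The weight for which every nonzero coefficient has weight `1`. -/
noncomputable def countWeight {R : Type*} [AddCommGroup R] (r : R) : ℝ≥0∞ :=
  if r = 0 then 0 else 1

theorem isWeight_countWeight (R : Type*) [AddCommGroup R] :
    IsWeight (countWeight : R → ℝ≥0∞) where
  zero := by simp [countWeight]
  neg r := by by_cases hr : r = 0 <;> simp [countWeight, hr]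
  add_le r s := by
    by_cases hr : r = 0
    · simp [hr]
    · have : countWeight (r + s) ≤ countWeight r := by
        simp only [countWeight, if_neg hr]
        split_ifs <;> simp
      exact this.trans le_self_add

theorem countMass_eq_sum {ι R : Type*} [AddCommGroup R] (c : ι →₀ R) :
    countMass c = c.sum fun _ r => countWeight r := by
  rw [countMass, Finsupp.sum, Finset.sum_congr rfl (g := fun _ => (1 : ℝ≥0∞))]
  · simp
  · intro i hi
    simp [countWeight, Finsupp.mem_support_iff.1 hi]

namespace IsWeight

variable {R : Type*} [AddCommGroup R] {ν : R → ℝ≥0∞} (hν : IsWeight ν)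
include hν

theorem zsmul_le (n : ℤ) (r : R) : ν (n • r) ≤ n.natAbs * ν r := by
  have nat (n : ℕ) : ν (n • r) ≤ n * ν r := by
    induction n with
    | zero => simp [hν.zero]
    | succ n ih =>
      rw [succ_nsmul, Nat.cast_succ, add_mul, one_mul]
      exact (hν.add_le _ _).trans (add_le_add_left ih _)
  obtain ⟨n, rfl | rfl⟩ := n.eq_nat_or_neg
  · simpa using nat n
  · simpa [hν.neg] using nat n

theorem sum_le {ι : Type*} (s : Finset ι) (f : ι → R) : ν (∑ i ∈ s, f i) ≤ ∑ i ∈ s, ν (f i) := by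
  classical
  induction s using Finset.induction_on with
  | empty => simp [hν.zero]
  | insert i s hi ih =>
    rw [Finset.sum_insert hi, Finset.sum_insert hi]
    exact (hν.add_le _ _).trans (add_le_add_right ih _)

theorem mass_add_le {ι : Type*} (c d : ι →₀ R) :
    ((c + d).sum fun _ r => ν r) ≤ (c.sum fun _ r => ν r) + d.sum fun _ r => ν r := by
  classical
  have h0 : ∀ i ∈ c.support ∪ d.support, ν 0 = 0 := fun _ _ => hν.zero
  rw [Finsupp.sum_of_support_subset _ Finsupp.support_add (fun _ r => ν r) h0,
    Finsupp.sum_of_support_subset _ Finset.subset_union_left (fun _ r => ν r) h0,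
    Finsupp.sum_of_support_subset _ Finset.subset_union_right (fun _ r => ν r) h0,
    ← Finset.sum_add_distrib]
  exact Finset.sum_le_sum fun i _ => hν.add_le _ _

theorem mass_neg {ι : Type*} (c : ι →₀ R) :
    ((-c).sum fun _ r => ν r) = c.sum fun _ r => ν r := by
  rw [Finsupp.sum_neg_index fun _ => hν.zero]
  simp [hν.neg]

theorem mass_pathSum_le {E : Type*} (r : R) (p : List (E × Bool)) :
    ((pathSum (fun e => Finsupp.single e r) p).sum fun _ r => ν r) ≤ p.length * ν r := by
  induction p with
  | nil => simp
  | cons s p ih =>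
    rw [pathSum_cons, List.length_cons, Nat.cast_succ, add_comm, add_mul, one_mul]
    refine (hν.mass_add_le _ _).trans (add_le_add ih ?_)
    split_ifs <;> simp [hν.mass_neg, hν.zero]

/-- A linear lower bound for the mass of a filling `β` of `α`, in terms of a family of integral
1-cochains that are nearly `-1` on `α` and whose coboundaries have few nonzero values on each
2-cell. -/
theorem le_mass_of_boundary₂_eq {X : TwoComplex.{u}} {c : ℕ → X.Edge → ℤ} {C : ℕ}
    (hC : ∀ d n, ∑ k ∈ Finset.range n, (pathSum (c k) (X.bdry d)).natAbs ≤ C)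
    {ρ : ℤ →+ R} (hρ : ν (ρ 1) = 1) {α : X.Edge →₀ ℤ} {β : X.Face →₀ R}
    (hβ : X.boundary₂ R β = Finsupp.mapRange.addMonoidHom ρ α) {N E : ℕ} {err : ℕ → ℤ}
    (herr : ∀ k < N, evalChain (c k) α = err k - 1)
    (hE : ∑ k ∈ Finset.range N, (err k).natAbs ≤ E) :
    (N : ℝ≥0∞) ≤ E + C * β.sum fun _ r => ν r := by
  -- For each level, `ρ 1` is an error term minus the value of `c k` on the boundary of `β`, and
  -- that value is the coboundary of `c k` evaluated on `β`.
  have key : ∀ k ∈ Finset.range N, (1 : ℝ≥0∞) ≤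
      (err k).natAbs + ∑ d ∈ β.support, (pathSum (c k) (X.bdry d)).natAbs * ν (β d) := by
    intro k hk
    have h1 : ρ 1 = err k • ρ 1 + -(evalChain (c k) (X.boundary₂ R β)) := by
      rw [hβ, evalChain_mapRange, herr k (Finset.mem_range.1 hk), map_sub, ← map_zsmul]
      simp
    rw [← hρ]
    nth_rewrite 1 [h1]
    refine (hν.add_le _ _).trans (add_le_add ((hν.zsmul_le _ _).trans (by rw [hρ, mul_one])) ?_)
    rw [hν.neg, TwoComplex.evalChain_boundary₂]
    exact (hν.sum_le _ _).trans (Finset.sum_le_sum fun d _ => hν.zsmul_le _ _)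
  calc (N : ℝ≥0∞) = ∑ k ∈ Finset.range N, 1 := by simp
    _ ≤ _ := Finset.sum_le_sum key
    _ = (∑ k ∈ Finset.range N, (err k).natAbs : ℕ) + ∑ d ∈ β.support,
        (∑ k ∈ Finset.range N, (pathSum (c k) (X.bdry d)).natAbs : ℕ) * ν (β d) := by
      rw [Finset.sum_add_distrib, Finset.sum_comm, Nat.cast_sum]
      simp_rw [Nat.cast_sum, Finset.sum_mul]
    _ ≤ E + ∑ d ∈ β.support, C * ν (β d) :=
      add_le_add (by exact_mod_cast hE) (Finset.sum_le_sum fun d _ =>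
        mul_le_mul_left (by exact_mod_cast hC d N) _)
    _ = _ := by rw [← Finset.mul_sum]; rfl

end IsWeight

/-! ### Word length -/

section WordLength

variable {G : Type*} [Group G] {S : Set G}

theorem wordLength_le {g : G} {l : List G} (hl : ∀ a ∈ l, a ∈ S ∨ a⁻¹ ∈ S) (h : l.prod = g) :
    wordLength S g ≤ l.length :=
  iInf₂_le l ⟨hl, h⟩

theorem exists_word_of_wordLength_ne_top {g : G} (h : wordLength S g ≠ ⊤) :
    ∃ l : List G, (∀ a ∈ l, a ∈ S ∨ a⁻¹ ∈ S) ∧ l.prod = g ∧ wordLength S g = l.length := by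
  have hne : Nonempty {l : List G // (∀ a ∈ l, a ∈ S ∨ a⁻¹ ∈ S) ∧ l.prod = g} := by
    by_contra hempty
    refine h (iInf₂_eq_top.2 fun l hl => (hempty ⟨l, hl⟩).elim)
  obtain ⟨⟨l, hl⟩, h⟩ := ENat.exists_eq_iInf
    fun l : {l : List G // (∀ a ∈ l, a ∈ S ∨ a⁻¹ ∈ S) ∧ l.prod = g} => (l.1.length : ℕ∞)
  refine ⟨l, hl.1, hl.2, ?_⟩
  rw [wordLength, iInf_subtype', ← h]

theorem wordLength_ne_top (hS : Subgroup.closure S = ⊤) (g : G) : wordLength S g ≠ ⊤ := by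
  have hg : g ∈ (Subgroup.closure S).toSubmonoid := by rw [hS]; trivial
  rw [Subgroup.closure_toSubmonoid] at hg
  obtain ⟨l, hl, h⟩ := Submonoid.exists_list_of_mem_closure hg
  exact ((wordLength_le (fun a ha => hl a ha) h).trans_lt (ENat.natCast_lt_top _)).ne

theorem wordLength_mul_le (g h : G) : wordLength S (g * h) ≤ wordLength S g + wordLength S h := by
  by_cases hg : wordLength S g = ⊤
  · simp [hg]
  by_cases hh : wordLength S h = ⊤
  · simp [hh]
  obtain ⟨l, hl, rfl, hg⟩ := exists_word_of_wordLength_ne_top hg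
  obtain ⟨m, hm, rfl, hh⟩ := exists_word_of_wordLength_ne_top hh
  rw [hg, hh]
  refine (wordLength_le (l := l ++ m) (fun a ha => ?_) (by simp)).trans (by simp)
  exact (List.mem_append.1 ha).elim (hl a) (hm a)

theorem wordLength_one : wordLength S (1 : G) = 0 :=
  le_antisymm (wordLength_le (l := []) (by simp) rfl) zero_le

end WordLength

/-! ### Level sets in the group ring -/

/-- The sum of the coefficients of `c` over the set `{y | k < height y}`. -/
noncomputable def levelSum {D : Type*} (height : D → ℕ) (k : ℕ) : MonoidAlgebra ℤ D →+ ℤ :=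
  (Finsupp.liftAddHom fun y => zmultiplesHom ℤ (if k < height y then 1 else 0)).comp
    MonoidAlgebra.coeffAddEquiv.toAddMonoidHom

section Group

variable {D : Type*} [Group D]

theorem levelSum_of (height : D → ℕ) (k : ℕ) (y : D) :
    levelSum height k (MonoidAlgebra.of ℤ D y) = if k < height y then 1 else 0 := by
  simp [levelSum]

/-- The two indicators differ exactly for `k` between `a` and `b`. -/
theorem sum_natAbs_sub_indicator_le {a b m : ℕ} (h : a ≤ b + m) (h' : b ≤ a + m) (n : ℕ) :
    ∑ k ∈ Finset.range n,
      ((if k < a then (1 : ℤ) else 0) - if k < b then 1 else 0).natAbs ≤ m := by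
  calc _ ≤ ∑ k ∈ Finset.range n, if k ∈ Finset.Ico (min a b) (max a b) then 1 else 0 := by
        refine Finset.sum_le_sum fun k _ => ?_
        simp only [Finset.mem_Ico]
        split_ifs <;> simp <;> omega
    _ ≤ (Finset.Ico (min a b) (max a b)).card := by
        rw [Finset.sum_ite_mem, Finset.sum_const, smul_eq_mul, mul_one]
        exact Finset.card_le_card Finset.inter_subset_right
    _ ≤ m := by rw [Nat.card_Ico]; omega

/-- The level sums of every translate of `c` have total absolute value at most `C`. -/
def Narrow (height : D → ℕ) (c : MonoidAlgebra ℤ D) (C : ℕ) : Prop :=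
  ∀ (x : D) (n : ℕ), ∑ k ∈ Finset.range n,
    (levelSum height k (MonoidAlgebra.of ℤ D x * c)).natAbs ≤ C

namespace Narrow

variable {height : D → ℕ} {c c' : MonoidAlgebra ℤ D} {C C' : ℕ}

theorem zero : Narrow height 0 0 := fun x n => by simp

theorem mono (h : Narrow height c C) (hC : C ≤ C') : Narrow height c C' :=
  fun x n => (h x n).trans hC

theorem add (h : Narrow height c C) (h' : Narrow height c' C') :
    Narrow height (c + c') (C + C') := fun x n => by
  refine le_trans ?_ (add_le_add (h x n) (h' x n))
  rw [← Finset.sum_add_distrib]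
  refine Finset.sum_le_sum fun k _ => ?_
  rw [mul_add, map_add]
  exact Int.natAbs_add_le _ _

theorem neg (h : Narrow height c C) : Narrow height (-c) C := fun x n => by
  simpa using h x n

theorem of_mul (h : Narrow height c C) (y : D) :
    Narrow height (MonoidAlgebra.of ℤ D y * c) C := fun x n => by
  rw [← mul_assoc, ← map_mul]
  exact h (x * y) n

/-- Narrowness quantifies over all left translates, so group elements preserve the constant; a
general `a` is a finite sum of elements `±y`. -/
theorem exists_mul (h : Narrow height c C) (a : MonoidAlgebra ℤ D) :
    ∃ C', Narrow height (a * c) C' := by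
  induction a using MonoidAlgebra.induction_on with
  | of y => exact ⟨C, h.of_mul y⟩
  | add a b ha hb =>
    obtain ⟨A, hA⟩ := ha
    obtain ⟨B, hB⟩ := hb
    exact ⟨A + B, by rw [add_mul]; exact hA.add hB⟩
  | smul r a ha =>
    obtain ⟨A, hA⟩ := ha
    rw [smul_mul_assoc]
    induction r using Int.induction_on with
    | zero => exact ⟨0, by simpa using zero⟩
    | succ n ih =>
      obtain ⟨A', hA'⟩ := ih
      exact ⟨A' + A, by rw [add_smul, one_smul]; exact hA'.add hA⟩
    | pred n ih =>
      obtain ⟨A', hA'⟩ := ih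
      exact ⟨A' + A, by rw [sub_smul, one_smul, sub_eq_add_neg]; exact hA'.add hA.neg⟩

end Narrow

/-- The left ideal of the group ring generated by the elements `t - 1`, for `t` in the image
of `ι`. -/
noncomputable def augmentation {F : Type*} [Group F] (ι : F →* D) :
    Submodule (MonoidAlgebra ℤ D) (MonoidAlgebra ℤ D) :=
  Submodule.span _ (Set.range fun t => MonoidAlgebra.of ℤ D (ι t) - 1)

/-- For a generator, `x * (t - 1)` has nonzero level sums only between the heights of `x` and `x *
t`. -/
theorem exists_narrow_of_mem_augmentation {F : Type*} [Group F] {ι : F →* D} {height : D → ℕ}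
    (h : ∀ t, ∃ m, ∀ x, height x ≤ height (x * ι t) + m ∧ height (x * ι t) ≤ height x + m)
    {c : MonoidAlgebra ℤ D} (hc : c ∈ augmentation ι) : ∃ C, Narrow height c C := by
  induction hc using Submodule.span_induction with
  | mem c hc =>
    obtain ⟨t, rfl⟩ := hc
    obtain ⟨m, hm⟩ := h t
    refine ⟨m, fun x n => ?_⟩
    simp only [mul_sub, mul_one, ← map_mul, map_sub, levelSum_of]
    exact sum_natAbs_sub_indicator_le (hm x).2 (hm x).1 n
  | zero => exact ⟨0, Narrow.zero⟩
  | add c d _ _ hc hd =>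
    obtain ⟨A, hA⟩ := hc
    obtain ⟨B, hB⟩ := hd
    exact ⟨A + B, hA.add hB⟩
  | smul a c _ hc =>
    obtain ⟨A, hA⟩ := hc
    exact hA.exists_mul a

end Group

/-! ### Heights on the double and the Bass-Serre derivation -/

namespace Double

variable {B : Type u} [Group B] (F : Subgroup B)

/-- The word length of the elements of `F`, extended by zero to the double. -/
noncomputable def height (T : Set F) : Double F → ℕ :=
  Function.extend (fun t : F => incl F 0 t) (fun t => (wordLength T t).toNat) 0

theorem incl_coe_injective : Function.Injective fun t : F => incl F 0 t :=
  (incl_injective F 0).comp Subtype.val_injective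

theorem height_incl (T : Set F) (t : F) : height F T (incl F 0 t) = (wordLength T t).toNat :=
  (incl_coe_injective F).extend_apply ..

/-- Right translation by `F` preserves both `F` and its complement, where the height is `0`; on `F`
this is the triangle inequality. -/
theorem height_mul_le {T : Set F} (hT : Subgroup.closure T = ⊤) (x : Double F) (t : F) :
    height F T (x * incl F 0 t) ≤ height F T x + (wordLength T t).toNat := by
  by_cases hx : ∃ s : F, incl F 0 s = x
  · obtain ⟨s, rfl⟩ := hx
    rw [← map_mul, ← Subgroup.coe_mul, height_incl, height_incl,
      ← ENat.toNat_add (wordLength_ne_top hT s) (wordLength_ne_top hT t)]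
    exact ENat.toNat_le_toNat (wordLength_mul_le s t)
      (by simp [wordLength_ne_top hT])
  · have hxt : ¬∃ s : F, incl F 0 s = x * incl F 0 t := by
      rintro ⟨s, hs⟩
      exact hx ⟨s * t⁻¹, by simp [hs]⟩
    rw [height, Function.extend_apply' _ _ _ hxt]
    exact Nat.zero_le _

theorem exists_height_le {T : Set F} (hT : Subgroup.closure T = ⊤) (t : F) :
    ∃ m, ∀ x, height F T x ≤ height F T (x * (incl F 0).comp F.subtype t) + m ∧
      height F T (x * (incl F 0).comp F.subtype t) ≤ height F T x + m := by
  refine ⟨(wordLength T t).toNat + (wordLength T t⁻¹).toNat, fun x => ⟨?_, ?_⟩⟩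
  · have := height_mul_le F hT (x * incl F 0 t) t⁻¹
    simp at this ⊢
    omega
  · have := height_mul_le F hT x t
    simp at this ⊢
    omega

/-- The group ring of the double modulo the left ideal generated by the elements `t - 1` for
`t ∈ F`: the free abelian group on the edges of the Bass-Serre tree. -/
abbrev TreeChain : Type u :=
  MonoidAlgebra ℤ (Double F) ⧸ augmentation ((incl F 0).comp F.subtype)

/-- The derivation of the double that sends `x` to the chain of the path in the Bass-Serre tree
from a base vertex to its translate by `x`. -/
theorem exists_derivation : ∃ δ : Double F → TreeChain F,
    (∀ x y, δ (x * y) = MonoidAlgebra.of ℤ _ x • δ y + δ x) ∧ (∀ b, δ (incl F 0 b) = 0) ∧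
    ∀ b, δ (incl F 1 b) = Submodule.Quotient.mk (MonoidAlgebra.of ℤ _ (incl F 1 b) - 1) := by
  let M := TreeChain F
  let e : M := Submodule.Quotient.mk 1
  -- This is the linear action conjugated by a translation, with fixed point `-z`. With `z = 0` and
  -- `z = e`, the two copies of `B` fix the two ends of the edge `e` of the tree.
  let act (i : Fin 2) (z : M) : B →* Function.End M :=
    { toFun := fun b m => MonoidAlgebra.of ℤ _ (incl F i b) • (m + z) - z
      map_one' := by
        funext m
        rw [map_one, map_one, one_smul, add_sub_cancel_right]
        rfl
      map_mul' := fun b b' => by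
        funext m
        change _ = MonoidAlgebra.of ℤ _ (incl F i b) •
          (MonoidAlgebra.of ℤ _ (incl F i b') • (m + z) - z + z) - z
        rw [sub_add_cancel, smul_smul, map_mul, map_mul] }
  -- The two affine actions agree on `F` because `F` fixes `e`. The derivation is the translation
  -- part `Ψ x 0`.
  obtain ⟨Ψ, h₀, h₁⟩ := exists_lift F (act 0 0) (act 1 e) fun t => by
    have h : MonoidAlgebra.of ℤ _ (incl F 0 t) • e = e := by
      rw [← Submodule.Quotient.mk_smul, Submodule.Quotient.eq, smul_eq_mul, mul_one]
      exact Submodule.subset_span ⟨t, rfl⟩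
    funext m
    change MonoidAlgebra.of ℤ _ (incl F 0 t) • (m + 0) - 0
      = MonoidAlgebra.of ℤ _ (incl F 1 t) • (m + e) - e
    rw [← incl_coe F 0 1, smul_add _ m e, h, add_zero, sub_zero, add_sub_cancel_right]
  have hΨ₀ (b : B) (m : M) : Ψ (incl F 0 b) m = MonoidAlgebra.of ℤ _ (incl F 0 b) • m := by
    have := congrFun (DFunLike.congr_fun h₀ b) m
    exact this.trans (by change _ • (m + 0) - 0 = _; rw [add_zero, sub_zero])
  have hΨ₁ (b : B) (m : M) :
      Ψ (incl F 1 b) m = MonoidAlgebra.of ℤ _ (incl F 1 b) • (m + e) - e :=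
    congrFun (DFunLike.congr_fun h₁ b) m
  have affine (x : Double F) (m : M) : Ψ x m = MonoidAlgebra.of ℤ _ x • m + Ψ x 0 := by
    refine induction_on (p := fun x => ∀ m, Ψ x m = MonoidAlgebra.of ℤ _ x • m + Ψ x 0) x
      (fun b m => by simp [hΨ₀]) (fun b m => ?_) (fun x y hx hy m => ?_) m
    · rw [hΨ₁, hΨ₁, zero_add, smul_add, add_sub_assoc]
    · have hmul (m : M) : Ψ (x * y) m = Ψ x (Ψ y m) := by rw [map_mul]; rfl
      rw [hmul, hmul, hx (Ψ y m), hy m, hx (Ψ y 0), map_mul, smul_add, smul_smul, add_assoc]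
  refine ⟨fun x => Ψ x 0, fun x y => ?_, fun b => by simp [hΨ₀], fun b => ?_⟩
  · change Ψ (x * y) 0 = _
    rw [map_mul]
    exact affine x _
  · change Ψ (incl F 1 b) 0 = _
    rw [hΨ₁, zero_add, ← Submodule.Quotient.mk_smul, smul_eq_mul, mul_one,
      Submodule.Quotient.mk_sub]

end Double

/-! ### Equivariant choices -/

/-- Values are chosen on orbit representatives and transported by the group element, unique by
freeness, that carries the representative to the given point. -/
theorem exists_equivariant {G V N : Type*} [Group G] [MulAction G V]
    (free : ∀ (g : G) (v : V), g • v = v → g = 1) (act : G → N → N)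
    (act_mul : ∀ g h n, act (g * h) n = act g (act h n)) {p : V → N → Prop}
    (hp : ∀ g v n, p v n → p (g • v) (act g n)) (hex : ∀ v, ∃ n, p v n) :
    ∃ f : V → N, (∀ g v, f (g • v) = act g (f v)) ∧ ∀ v, p v (f v) := by
  choose n hn using hex
  let rep (v : V) : V :=
    Quotient.out (s := MulAction.orbitRel G V) (Quotient.mk _ v)
  have hrep (v : V) : ∃ g : G, g • rep v = v :=
    (MulAction.orbitRel G V).symm' (Quotient.mk_out (s := MulAction.orbitRel G V) v)
  have rep_smul (g : G) (v : V) : rep (g • v) = rep v :=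
    congrArg Quotient.out (Quotient.sound (s := MulAction.orbitRel G V) ⟨g, rfl⟩)
  choose γ hγ using hrep
  have γ_smul (g : G) (v : V) : γ (g • v) = g * γ v := by
    have h : ((g * γ v)⁻¹ * γ (g • v)) • rep v = rep v := by
      rw [mul_smul, inv_smul_eq_iff, mul_smul, hγ v, ← rep_smul g v]
      exact hγ _
    exact (inv_mul_eq_one.1 (free _ _ h)).symm
  refine ⟨fun v => act (γ v) (n (rep v)), fun g v => ?_, fun v => ?_⟩
  · simp only [γ_smul, rep_smul, act_mul]
  · have := hp (γ v) _ _ (hn (rep v))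
    rwa [hγ] at this

/-! ### Words and loops in the complex -/

section Words

variable {X : TwoComplex.{v}} {D B : Type*} [Group D] [Group B] [MulAction D X.Vert]
  [MulAction D X.Edge] [MulAction D X.Face]

/-- A word in finitely many letters traces an edge path along which the cochain `φ` differs from
a coboundary by an error of linear size. -/
theorem exists_walk_of_word (hX : X.IsFreeGeometricAction D) (hconn : ∀ a b, ∃ p, X.IsWalk a p b)
    {K : Submodule (MonoidAlgebra ℤ D) (MonoidAlgebra ℤ D)} {height : D → ℕ}
    (hK : ∀ c ∈ K, ∃ C, Narrow height c C) {φ : X.Edge → MonoidAlgebra ℤ D}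
    (hφ : ∀ (g : D) e, φ (g • e) = MonoidAlgebra.of ℤ D g * φ e)
    {q : X.Vert → MonoidAlgebra ℤ D ⧸ K}
    (hφq : ∀ e, Submodule.Quotient.mk (φ e) = q (X.tgt e) - q (X.src e))
    (f : B →* D) (v : X.Vert) (m : MonoidAlgebra ℤ D)
    (hm : ∀ b, Submodule.Quotient.mk (MonoidAlgebra.of ℤ D (f b) * m - m) = q (f b • v) - q v)
    {A : Set B} (hA : A.Finite) :
    ∃ C : ℕ, ∀ l : List B, (∀ a ∈ l, a ∈ A) → ∃ p κ, X.IsWalk v p (f l.prod • v) ∧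
      p.length ≤ C * l.length ∧ pathSum φ p = MonoidAlgebra.of ℤ D (f l.prod) * m - m + κ ∧
      Narrow height κ (C * l.length) := by
  choose p hp using fun b : B => hconn v (f b • v)
  -- Modulo `K` the cochain `φ` is the coboundary of `q`, so its sum along a path depends only on
  -- the endpoints.
  have hκ (b : B) : pathSum φ (p b) - (MonoidAlgebra.of ℤ D (f b) * m - m) ∈ K := by
    rw [← Submodule.Quotient.eq, hm]
    exact (map_pathSum φ K.mkQ.toAddMonoidHom (p b)).trans ((hp b).pathSum_eq hφq)
  choose C hC using fun b => hK _ (hκ b)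
  obtain ⟨C', hC'⟩ := (hA.image fun b => max (C b) (p b).length).bddAbove
  refine ⟨C', fun l => ?_⟩
  induction l with
  | nil =>
    refine fun _ => ⟨[], 0, ?_, Nat.zero_le _, ?_, Narrow.zero.mono (Nat.zero_le _)⟩
    · simp [OrGraph.IsWalk]
    · rw [List.prod_nil, map_one f, map_one, one_mul, sub_self, add_zero, pathSum_nil]
  | cons a l ih =>
    intro hl
    obtain ⟨w, κ, hw, hlen, hsum, hnar⟩ := ih fun b hb => hl b (List.mem_cons_of_mem _ hb)
    have ha := max_le_iff.1 (hC' (Set.mem_image_of_mem _ (hl a List.mem_cons_self)))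
    -- The main terms telescope, `(a m - m) + a (l m - m) = (a l) m - m`, while the errors add up,
    -- left translation preserving narrowness.
    refine ⟨p a ++ w.map fun s => (f a • s.1, s.2),
      pathSum φ (p a) - (MonoidAlgebra.of ℤ D (f a) * m - m) + MonoidAlgebra.of ℤ D (f a) * κ,
      ?_, ?_, ?_, ?_⟩
    · rw [List.prod_cons, map_mul, mul_smul]
      exact (hp a).append (hw.smul hX.src_smul hX.tgt_smul (f a))
    · rw [List.length_append, List.length_map, List.length_cons, mul_add, mul_one, add_comm]
      exact add_le_add hlen ha.2
    · have hmul : pathSum (fun e => MonoidAlgebra.of ℤ D (f a) * φ e) w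
          = MonoidAlgebra.of ℤ D (f a) * pathSum φ w :=
        (map_pathSum φ (AddMonoidHom.mulLeft (MonoidAlgebra.of ℤ D (f a))) w).symm
      rw [pathSum_append, pathSum_map]
      simp only [hφ]
      rw [hmul, hsum, List.prod_cons, map_mul f, map_mul (MonoidAlgebra.of ℤ D), mul_add, mul_sub,
        ← mul_assoc]
      generalize MonoidAlgebra.of ℤ D (f a) * κ = x
      abel
    · rw [List.length_cons, Nat.mul_succ, Nat.add_comm (C' * _)]
      exact ((hC a).mono ha.1).add (hnar.of_mul (f a))

/-- Boundary paths are closed, so their `φ`-sums vanish modulo `K`. Translating a 2-cell translates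
the sum, so the finitely many orbits give a uniform constant. -/
theorem exists_narrow_bdry (hX : X.IsFreeGeometricAction D)
    {K : Submodule (MonoidAlgebra ℤ D) (MonoidAlgebra ℤ D)} {height : D → ℕ}
    (hK : ∀ c ∈ K, ∃ C, Narrow height c C) {φ : X.Edge → MonoidAlgebra ℤ D}
    (hφ : ∀ (g : D) e, φ (g • e) = MonoidAlgebra.of ℤ D g * φ e)
    {q : X.Vert → MonoidAlgebra ℤ D ⧸ K}
    (hφq : ∀ e, Submodule.Quotient.mk (φ e) = q (X.tgt e) - q (X.src e)) :
    ∃ C, ∀ d, Narrow height (pathSum φ (X.bdry d)) C := by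
  have hmem (d : X.Face) : pathSum φ (X.bdry d) ∈ K := by
    rw [← Submodule.Quotient.mk_eq_zero]
    exact (map_pathSum φ K.mkQ.toAddMonoidHom _).trans
      (((X.bdry_isWalk d).pathSum_eq hφq).trans (sub_self _))
  choose C hC using fun d => hK _ (hmem d)
  have := hX.finite_face
  obtain ⟨C', hC'⟩ := (Set.finite_range fun o : MulAction.orbitRel.Quotient D X.Face =>
    C (Quotient.out o)).bddAbove
  refine ⟨C', fun d => ?_⟩
  obtain ⟨g, hg⟩ : ∃ g : D,
      g • Quotient.out (s := MulAction.orbitRel D X.Face) (Quotient.mk _ d) = d :=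
    (MulAction.orbitRel D X.Face).symm' (Quotient.mk_out (s := MulAction.orbitRel D X.Face) d)
  rw [← hg, hX.bdry_smul, pathSum_map]
  simp only [hφ]
  have hmul (p : List (X.Edge × Bool)) : pathSum (fun e => MonoidAlgebra.of ℤ D g * φ e) p
      = MonoidAlgebra.of ℤ D g * pathSum φ p :=
    (map_pathSum φ (AddMonoidHom.mulLeft (MonoidAlgebra.of ℤ D g)) p).symm
  rw [hmul]
  exact ((hC _).mono (hC' ⟨_, rfl⟩)).of_mul g

end Words

/-! ### The lower bound -/

section LowerBound

variable {B : Type u} [Group B] {F : Subgroup B} {X : TwoComplex.{v}}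
  [MulAction (Double F) X.Vert] [MulAction (Double F) X.Edge] [MulAction (Double F) X.Face]

/-- The map `q` is equivariant for the affine action `m ↦ g m + δ g`. The terms `δ g` cancel in its
coboundary, which is thus equivariant for the linear action and can be lifted to the group ring
orbit by orbit. -/
theorem exists_edge_cochain (hX : X.IsFreeGeometricAction (Double F)) :
    ∃ (φ : X.Edge → MonoidAlgebra ℤ (Double F)) (q : X.Vert → Double.TreeChain F),
      (∀ g e, φ (g • e) = MonoidAlgebra.of ℤ _ g * φ e) ∧
      (∀ e, Submodule.Quotient.mk (φ e) = q (X.tgt e) - q (X.src e)) ∧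
      (∀ b v, q (Double.incl F 0 b • v) = MonoidAlgebra.of ℤ _ (Double.incl F 0 b) • q v) ∧
      ∀ b v, q (Double.incl F 1 b • v) = MonoidAlgebra.of ℤ _ (Double.incl F 1 b) • q v +
        Submodule.Quotient.mk (MonoidAlgebra.of ℤ _ (Double.incl F 1 b) - 1) := by
  obtain ⟨δ, hδ, hδ₀, hδ₁⟩ := Double.exists_derivation F
  obtain ⟨q, hq, -⟩ := exists_equivariant (V := X.Vert) hX.free
    (fun g (m : Double.TreeChain F) => MonoidAlgebra.of ℤ _ g • m + δ g)
    (fun g h m => by rw [hδ, map_mul, mul_smul, smul_add, add_assoc])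
    (p := fun _ _ => True) (fun _ _ _ _ => trivial) fun _ => ⟨0, trivial⟩
  obtain ⟨φ, hφ, hφq⟩ := exists_equivariant (V := X.Edge)
    (fun g e h => hX.free g (X.src e) (by rw [← hX.src_smul, h]))
    (fun g (m : MonoidAlgebra ℤ (Double F)) => MonoidAlgebra.of ℤ _ g * m)
    (fun g h m => by rw [map_mul, mul_assoc])
    (p := fun e m => Submodule.Quotient.mk m = q (X.tgt e) - q (X.src e))
    (fun g e m h => by
      rw [hX.tgt_smul, hX.src_smul, hq, hq, add_sub_add_right_eq_sub, ← smul_sub, ← h,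
        ← Submodule.Quotient.mk_smul, smul_eq_mul])
    fun e => Submodule.Quotient.mk_surjective _ _
  exact ⟨φ, q, hφ, hφq, fun b v => by rw [hq, hδ₀, add_zero], fun b v => by rw [hq, hδ₁]⟩

/-- For every word of length `n` in the generators of `B` representing an element `g` of `F`,
there is a loop of length `O(n)` that crosses the coset `F` in the Bass-Serre tree at `1` and
`g`, up to an error of size `O(n)`. -/
theorem exists_cochains (hX₁ : X.SimplyConnected)
    (hX : X.IsFreeGeometricAction (Double F)) (S : Finset B) {T : Set F}
    (hT : Subgroup.closure T = ⊤) :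
    ∃ (C : ℕ) (c : ℕ → X.Edge → ℤ),
      (∀ d n, ∑ k ∈ Finset.range n, (pathSum (c k) (X.bdry d)).natAbs ≤ C) ∧
      ∀ (l : List B), (∀ a ∈ l, a ∈ S ∨ a⁻¹ ∈ S) → ∀ g : F, l.prod = g →
      ∃ a b p p', X.IsWalk a p b ∧ X.IsWalk a p' b ∧ p.length ≤ C * l.length ∧
        p'.length ≤ C * l.length ∧ ∃ err : ℕ → ℤ,
          (∀ k < (wordLength T g).toNat, pathSum (c k) p - pathSum (c k) p' = err k - 1) ∧
          ∀ n, ∑ k ∈ Finset.range n, (err k).natAbs ≤ C * l.length := by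
  obtain ⟨φ, q, hφ, hφq, hq₀, hq₁⟩ := exists_edge_cochain hX
  have hK := fun c => exists_narrow_of_mem_augmentation (c := c) (Double.exists_height_le F hT)
  obtain ⟨C, hC⟩ := exists_narrow_bdry hX hK hφ hφq
  obtain ⟨v⟩ := hX₁.nonempty
  obtain ⟨m, hm⟩ := Submodule.Quotient.mk_surjective _ (q v)
  have hA : {a : B | a ∈ S ∨ a⁻¹ ∈ S}.Finite :=
    S.finite_toSet.union (S.finite_toSet.preimage inv_injective.injOn)
  obtain ⟨C₀, hC₀⟩ := exists_walk_of_word hX hX₁.connected hK hφ hφq (Double.incl F 0) v m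
    (fun b => by
      rw [hq₀, ← hm, ← Submodule.Quotient.mk_smul, ← Submodule.Quotient.mk_sub, smul_eq_mul]) hA
  -- The derivation on the second copy shifts the lift `m` of `q v` to `m + 1`; this extra `1`
  -- produces the crossings at `1` and `g`.
  obtain ⟨C₁, hC₁⟩ := exists_walk_of_word hX hX₁.connected hK hφ hφq (Double.incl F 1) v (m + 1)
    (fun b => by
      rw [hq₁, ← hm, ← Submodule.Quotient.mk_smul, ← Submodule.Quotient.mk_add,
        ← Submodule.Quotient.mk_sub, smul_eq_mul, mul_add, mul_one]
      congr 1
      abel) hA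
  have hsum (k : ℕ) (p : List (X.Edge × Bool)) :
      pathSum (fun e => levelSum (Double.height F T) k (φ e)) p
        = levelSum (Double.height F T) k (pathSum φ p) := (map_pathSum φ _ p).symm
  refine ⟨C + (C₀ + C₁), fun k e => levelSum (Double.height F T) k (φ e), fun d n => ?_,
    fun l hl g hg => ?_⟩
  · have := hC d 1 n
    simp only [map_one, one_mul] at this
    simp only [hsum]
    omega
  · obtain ⟨p₀, κ₀, hp₀, hlen₀, hs₀, hκ₀⟩ := hC₀ l hl
    obtain ⟨p₁, κ₁, hp₁, hlen₁, hs₁, hκ₁⟩ := hC₁ l hl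
    -- Since `g ∈ F`, its images under both inclusions coincide and the two paths have the same
    -- endpoint.
    rw [hg, Double.incl_coe F 1 0] at hp₁ hs₁
    rw [hg] at hp₀ hs₀
    have hle₀ : C₀ * l.length ≤ (C + (C₀ + C₁)) * l.length := Nat.mul_le_mul_right _ (by omega)
    have hle₁ : C₁ * l.length ≤ (C + (C₀ + C₁)) * l.length := Nat.mul_le_mul_right _ (by omega)
    have hle : C₀ * l.length + C₁ * l.length ≤ (C + (C₀ + C₁)) * l.length := by
      rw [← add_mul]
      exact Nat.mul_le_mul_right _ (by omega)
    refine ⟨_, _, p₀, p₁, hp₀, hp₁, hlen₀.trans hle₀, hlen₁.trans hle₁,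
      fun k => levelSum (Double.height F T) k (κ₀ + -κ₁), fun k hk => ?_, fun n => ?_⟩
    · have h1 : levelSum (Double.height F T) k 1 = 0 := by
        have h := levelSum_of (Double.height F T) k (Double.incl F 0 (1 : F))
        rw [Double.height_incl, wordLength_one, OneMemClass.coe_one, map_one, map_one] at h
        exact h
      have hg : levelSum (Double.height F T) k (MonoidAlgebra.of ℤ _ (Double.incl F 0 g)) = 1 := by
        rw [levelSum_of, Double.height_incl, if_pos hk]
      rw [hsum, hsum, hs₀, hs₁, ← map_sub, mul_add, mul_one]
      -- All terms in `m` cancel, leaving `κ₀ - κ₁ - (g - 1)`. At level `k` the element `1`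
      -- contributes nothing, having height `0`, and `g` contributes `1`.
      rw [show ∀ a b c d e : MonoidAlgebra ℤ (Double F),
        a - b + d - (a + c - (b + 1) + e) = d + -e - (c - 1) from fun a b c d e => by abel,
        map_sub, map_sub, h1, hg, sub_zero]
    · have := (hκ₀.add hκ₁.neg) 1 n
      simp only [map_one, one_mul] at this
      exact this.trans hle

/-- The filling functions of `X`, for an abstract weight on the coefficients, bound the
distortion of `F`. -/
theorem distortion_growthLE (hX₁ : X.SimplyConnected)
    (hX : X.IsFreeGeometricAction (Double F)) (S : Finset B) {T : Set F}
    (hT : Subgroup.closure T = ⊤) {R : Type*} [AddCommGroup R] {ν : R → ℝ≥0∞}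
    (hν : IsWeight ν) {ρ : ℤ →+ R} (hρ : ν (ρ 1) = 1) {FV : ℝ≥0 → ℝ≥0∞}
    (hFV : ∀ (x : ℝ≥0) (p p' : List (X.Edge × Bool)) (a b : X.Vert), X.IsWalk a p b →
      X.IsWalk a p' b → (p.length + p'.length : ℝ≥0) ≤ x →
      ⨅ (β : X.Face →₀ R) (_ : X.boundary₂ R β =
        Finsupp.mapRange.addMonoidHom ρ (X.pathChain p - X.pathChain p')),
        (β.sum fun _ r => ν r) ≤ FV x) :
    GrowthLE (distortion F S T) FV := by
  obtain ⟨C, c, hC, hloop⟩ := exists_cochains hX₁ hX S hT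
  -- Each path has length at most `C * l.length`, so `2 * C` covers the loop; adding `1` makes the
  -- constant positive. It also dominates the factor `C` on the mass and on the error.
  refine ⟨2 * C + 1, by positivity, fun x => iSup₂_le fun g hg => ?_⟩
  have hfin : wordLength (S : Set B) (g : B) ≠ ⊤ := by
    intro h
    rw [h] at hg
    simp at hg
  obtain ⟨l, hl, hprod, hlen⟩ := exists_word_of_wordLength_ne_top hfin
  rw [hlen] at hg
  replace hg : (l.length : ℝ≥0) ≤ x := by
    rw [ENat.toENNReal_coe] at hg
    exact_mod_cast hg
  obtain ⟨a, b, p, p', hp, hp', hlp, hlp', err, herr, hE⟩ := hloop l hl g hprod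
  have hmass := hFV ((2 * C + 1) * x + (2 * C + 1)) p p' a b hp hp' (by
    calc (p.length + p'.length : ℝ≥0) ≤ C * l.length + C * l.length :=
          add_le_add (by exact_mod_cast hlp) (by exact_mod_cast hlp')
      _ = 2 * C * l.length := by ring
      _ ≤ (2 * C + 1) * x := mul_le_mul' le_self_add hg
      _ ≤ _ := le_self_add)
  have hT' : ((wordLength T g).toNat : ℝ≥0∞) = wordLength T g := by
    conv_rhs => rw [← ENat.natCast_toNat (wordLength_ne_top hT g)]
    rfl
  rw [← hT']
  have hC0 : ((2 * C + 1 : ℝ≥0) : ℝ≥0∞) ≠ 0 := by simp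
  have hbound : ((wordLength T g).toNat : ℝ≥0∞) ≤ (C * l.length : ℕ) +
      ((2 * C + 1 : ℝ≥0) : ℝ≥0∞) * FV ((2 * C + 1) * x + (2 * C + 1)) := by
    refine le_trans ?_ (add_le_add_right (mul_le_mul_right hmass _) _)
    -- The inequality is solved for the infimum, so that it can be checked on each filling `β`
    -- separately.
    rw [← tsub_le_iff_left, mul_comm ((2 * C + 1 : ℝ≥0) : ℝ≥0∞),
      ← ENNReal.div_le_iff hC0 ENNReal.coe_ne_top]
    refine le_iInf₂ fun β hβ => ?_
    rw [ENNReal.div_le_iff hC0 ENNReal.coe_ne_top, mul_comm _ ((2 * C + 1 : ℝ≥0) : ℝ≥0∞),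
      tsub_le_iff_left]
    refine (hν.le_mass_of_boundary₂_eq hC hρ hβ (fun k hk => ?_) (hE _)).trans
      (add_le_add_right (mul_le_mul_left ?_ _) _)
    · rw [map_sub, TwoComplex.evalChain_pathChain, TwoComplex.evalChain_pathChain, herr k hk]
    · have : (C : ℝ≥0) ≤ 2 * C + 1 := by
        rw [two_mul, add_assoc]
        exact le_self_add
      exact_mod_cast this
  refine hbound.trans ?_
  rw [add_comm, add_assoc]
  refine add_le_add_right (le_trans ?_ le_self_add) _
  have : (C * l.length : ℝ≥0) ≤ (2 * C + 1) * x :=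
    mul_le_mul' (by rw [two_mul, add_assoc]; exact le_self_add) hg
  exact_mod_cast this

theorem normFV_growthGE (hX₁ : X.SimplyConnected)
    (hX : X.IsFreeGeometricAction (Double F)) (S : Finset B) {T : Set F}
    (hT : Subgroup.closure T = ⊤) (R : Type*) [NormedRing R] (hR : ‖(1 : R)‖ₑ = 1) :
    GrowthLE (distortion F S T) (X.normFV R) := by
  refine distortion_growthLE hX₁ hX S hT (isWeight_enorm R) (ρ := Int.castAddHom R)
    (by simpa using hR) fun x p p' a b hp hp' hx => ?_
  have hcycle : X.boundary₁ ℤ (X.pathChain p - X.pathChain p') = 0 := by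
    have h := fun p hp => TwoComplex.boundary₁_mapRange_pathChain (AddMonoidHom.id ℤ) (p := p)
      (a := a) (b := b) hp
    simp only [Finsupp.mapRange.addMonoidHom_id, AddMonoidHom.id_apply] at h
    rw [map_sub, h p hp, h p' hp', sub_self]
  have hmass : normMass (X.pathChain p - X.pathChain p') ≤ x := by
    have hν := isWeight_enorm ℤ
    have h := fun p : List (X.Edge × Bool) => hν.mass_pathSum_le 1 p
    simp only [enorm_one, mul_one] at h
    rw [sub_eq_add_neg]
    refine (hν.mass_add_le _ _).trans ?_
    rw [hν.mass_neg]
    refine (add_le_add (h p) (h p')).trans ?_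
    exact_mod_cast hx
  exact le_iSup_of_le _ (le_iSup_of_le hcycle (le_iSup_of_le hmass le_rfl))

/-- The test cycles are the integral loops multiplied by one fixed nonzero coefficient `r`, which
has weight `1`. -/
theorem finFV_growthGE (hX₁ : X.SimplyConnected)
    (hX : X.IsFreeGeometricAction (Double F)) (S : Finset B) {T : Set F}
    (hT : Subgroup.closure T = ⊤) (R : Type*) [AddCommGroup R] [Nontrivial R] :
    GrowthLE (distortion F S T) (X.finFV R) := by
  obtain ⟨r, hr⟩ := exists_ne (0 : R)
  have hν := isWeight_countWeight R
  have hr1 : countWeight r = 1 := if_neg hr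
  refine distortion_growthLE hX₁ hX S hT hν (ρ := zmultiplesHom R r)
    (by simpa using hr1) fun x p p' a b hp hp' hx => ?_
  have hcycle : X.boundary₁ R (Finsupp.mapRange.addMonoidHom (zmultiplesHom R r)
      (X.pathChain p - X.pathChain p')) = 0 := by
    rw [map_sub, map_sub, TwoComplex.boundary₁_mapRange_pathChain _ hp,
      TwoComplex.boundary₁_mapRange_pathChain _ hp', sub_self]
  have hmass : countMass (Finsupp.mapRange.addMonoidHom (zmultiplesHom R r)
      (X.pathChain p - X.pathChain p')) ≤ x := by
    have h (p : List (X.Edge × Bool)) : ((Finsupp.mapRange.addMonoidHom (zmultiplesHom R r)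
        (X.pathChain p)).sum fun _ r => countWeight r) ≤ p.length := by
      have := hν.mass_pathSum_le r p
      rw [hr1, mul_one] at this
      rw [TwoComplex.pathChain, map_pathSum]
      simpa using this
    rw [countMass_eq_sum, map_sub, sub_eq_add_neg]
    refine (hν.mass_add_le _ _).trans ?_
    rw [hν.mass_neg]
    refine (add_le_add (h p) (h p')).trans ?_
    exact_mod_cast hx
  refine le_trans (le_of_eq ?_)
    (le_iSup_of_le _ (le_iSup_of_le hcycle (le_iSup_of_le hmass le_rfl)))
  simp only [TwoComplex.finFillVol, countMass_eq_sum]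

end LowerBound

end HomFill

theorem mainTheorem8 {B : Type u} [Group B] (hB : Group.IsFinitelyPresented B)
    (F : Subgroup B) (hF : F.FG) :
    Group.IsFinitelyPresented (HomFill.Double F) ∧
    ∀ (S : Finset B) (_ : Subgroup.closure (S : Set B) = ⊤)
      (T : Finset F) (_ : Subgroup.closure (T : Set F) = ⊤)
      (X : HomFill.TwoComplex.{v}) (_ : X.SimplyConnected)
      [MulAction (HomFill.Double F) X.Vert] [MulAction (HomFill.Double F) X.Edge]
      [MulAction (HomFill.Double F) X.Face]
      (_ : X.IsFreeGeometricAction (HomFill.Double F)),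
      HomFill.GrowthLE (HomFill.distortion F S T) (X.normFV ℤ) ∧
      HomFill.GrowthLE (HomFill.distortion F S T) (X.normFV ℚ) ∧
      ∀ (R : Type w) [AddCommGroup R] [Finite R] [Nontrivial R],
        HomFill.GrowthLE (HomFill.distortion F S T) (X.finFV R) := by
  refine ⟨HomFill.Double.isFinitelyPresented F hB hF, fun S _ T hT X hX₁ _ _ _ hX => ⟨?_, ?_, ?_⟩⟩
  · exact HomFill.normFV_growthGE hX₁ hX S hT ℤ enorm_one
  · exact HomFill.normFV_growthGE hX₁ hX S hT ℚ enorm_one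
  · intro R _ _ _
    exact HomFill.finFV_growthGE hX₁ hX S hT R
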